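/- Let $A$ be a finite alphabet and let $A^{-\mathbb N}$ be the set of semi-infinite sequences $\omega=(a_i)_{i\le -1}$ with values in $A$. Let $P(a\mid\omega)\in[0,1]$, $(\omega,a)\in A^{-\mathbb N}\times A$, be a transition kernel, i.e. $\sum_{a\in A}P(a\mid\omega)=1$ for every $\omega$. Let $X=(X_n)_{n\in\mathbb Z}$ be a stationary ergodic $A$-valued process on a probability space $(\Xi,\mathcal X,\mathbb P)$ that is compatible with $P$: for every $a\in A$, $P(a\mid X_{-\infty}^{-1})$ is a version of the conditional probability $\mathbb P(X_0=a\mid\sigma(X_i,\,i\le-1))$. For $k\ge 1$ put $$\|\epsilon\|_{k,\infty}=\sup_{a\in A,\ \omega\in A^{-\mathbb N}}\ \sup_{\omega',\omega''}\bigl|P(a\mid\omega')-P(a\mid\omega'')\bigr|,$$ where the inner supremum is over all $\omega',\omega''\in A^{-\mathbb N}$ whose $k$ most recent letters (those with indices $-k,\dots,-1$) are those of $\omega$. Assume that 1. (RC) $P(a\mid\omega)>0$ for all $(a,\omega)\in A\times A^{-\mathbb N}$; 2. there are $C>0$ and $\alpha>0$ such that $\|\epsilon\|_{k,\infty}\le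 Ce^{-\alpha k}$ for all $k\ge 1$. For $k\in\mathbb N$ let $$\beta_k=\frac12\sup\sum_{i=1}^{I}\sum_{j=1}^{J}\bigl|\mathbb P(E_i\cap F_j)-\mathbb P(E_i)\,\mathbb P(F_j)\bigr|,$$ where the supremum is over all finite partitions $(E_i)_{i\le I}$ and $(F_j)_{j\le J}$ of $\Xi$ with $E_i\in\sigma(X_n,\,n\le 0)$ and $F_j\in\sigma(X_n,\,n\ge k)$. Then $X$ is geometrically mixing (GMC): there are $L>0$ and $\gamma>0$ such that $\beta_k\le Le^{-\gamma k}$ for all $k\in\mathbb N$. -/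

import Mathlib

open MeasureTheory

noncomputable section

namespace ChainMixing

/-- A transition kernel on the finite alphabet `A`. A past `w : ℕ → A` lists a semi-infinite
sequence `(a_i)_{i ≤ -1}` from the most recent letter backwards, `w j = a_{-1-j}`, and
`P.prob w a` is the transition probability `P(a | w)`. -/
structure TransitionKernel (A : Type*) [Fintype A] where
  prob : (ℕ → A) → A → ℝ
  prob_mem : ∀ w a, prob w a ∈ Set.Icc (0 : ℝ) 1
  sum_prob : ∀ w, ∑ a, prob w a = 1

/-- The left shift on two-sided sequences. -/
def shift (A : Type*) : (ℤ → A) → (ℤ → A) := fun x n => x (n + 1)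

/-- The process `(X_n)_{n ∈ ℤ}` is stationary and ergodic: its law on `ℤ → A` is invariant and
ergodic under the shift (`Ergodic` contains `MeasurePreserving`). -/
structure IsStationaryErgodic {Ω A : Type*} [MeasurableSpace Ω] [MeasurableSpace A]
    (X : ℤ → Ω → A) (μ : Measure Ω) : Prop where
  measurable : ∀ n, Measurable (X n)
  ergodic : Ergodic (shift A) (μ.map (fun ω n => X n ω))

/-- The past `X_{-∞}^{-1}` of the process. -/
def past {Ω A : Type*} (X : ℤ → Ω → A) (ω : Ω) : ℕ → A := fun j => X (-1 - (j : ℤ)) ω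

/-- The σ-algebra `σ(X_i, i ∈ S)`. -/
@[reducible] def sigmaOf {Ω A : Type*} [MeasurableSpace A] (X : ℤ → Ω → A) (S : Set ℤ) : MeasurableSpace Ω :=
  ⨆ i ∈ S, MeasurableSpace.comap (X i) inferInstance

/-- The process is compatible with `P`: for every letter `a`, `P(a | X_{-∞}^{-1})` is a version of
the conditional probability of `X_0 = a` given the past `σ(X_i, i ≤ -1)`. -/
def IsCompatible {Ω A : Type*} [MeasurableSpace Ω] [Fintype A] [MeasurableSpace A]
    (X : ℤ → Ω → A) (μ : Measure Ω) (P : TransitionKernel A) : Prop :=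
  ∀ a : A, μ[(X 0 ⁻¹' {a}).indicator (fun _ => (1 : ℝ)) | sigmaOf X (Set.Iic (-1))]
    =ᵐ[μ] fun ω => P.prob (past X ω) a

/-- The past whose `k` most recent letters are those of `w` and whose older letters are
those of `b`. -/
def graft {A : Type*} (k : ℕ) (w b : ℕ → A) : ℕ → A := fun j => if j < k then w j else b j

/-- The continuity rate `ε_k(w a)`: the supremum, over all pairs of remote pasts, of the variation
of `P(a | ·)` when the `k` most recent letters are fixed to those of `w`. -/
def contRate {A : Type*} [Fintype A] (P : TransitionKernel A) (k : ℕ) (w : ℕ → A) (a : A) : ℝ :=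
  ⨆ bc : (ℕ → A) × (ℕ → A), |P.prob (graft k w bc.1) a - P.prob (graft k w bc.2) a|

/-- The sup continuity rate `‖ε‖_{k,∞}`. -/
def supContRate {A : Type*} [Fintype A] (P : TransitionKernel A) (k : ℕ) : ℝ :=
  ⨆ wa : (ℕ → A) × A, contRate P k wa.1 wa.2

lemma abs_prob_sub_le_one {A : Type*} [Fintype A] (P : TransitionKernel A) (v w : ℕ → A) (a : A) :
    |P.prob v a - P.prob w a| ≤ 1 := by
  have h1 := P.prob_mem v a
  have h2 := P.prob_mem w a
  rw [abs_le]
  constructor <;> linarith [h1.1, h1.2, h2.1, h2.2]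

/-- The supremum defining `contRate` is over a bounded family. -/
lemma bddAbove_contRate {A : Type*} [Fintype A] (P : TransitionKernel A) (k : ℕ) (w : ℕ → A)
    (a : A) : BddAbove (Set.range fun bc : (ℕ → A) × (ℕ → A) =>
      |P.prob (graft k w bc.1) a - P.prob (graft k w bc.2) a|) :=
  ⟨1, by rintro _ ⟨bc, rfl⟩; exact abs_prob_sub_le_one P _ _ a⟩

/-- The supremum defining `supContRate` is over a bounded family. -/
lemma bddAbove_supContRate {A : Type*} [Fintype A] (P : TransitionKernel A) (k : ℕ) :
    BddAbove (Set.range fun wa : (ℕ → A) × A => contRate P k wa.1 wa.2) := by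
  refine ⟨1, ?_⟩
  rintro _ ⟨wa, rfl⟩
  exact Real.iSup_le (fun bc => abs_prob_sub_le_one P _ _ _) zero_le_one

/-- All transition probabilities are positive. -/
def RC {A : Type*} [Fintype A] (P : TransitionKernel A) : Prop :=
  ∀ (a : A) (w : ℕ → A), 0 < P.prob w a

/-- The sup continuity rates `‖ε‖_{k,∞}`, `k ≥ 1`, decay exponentially. -/
def ExpContinuityDecay {A : Type*} [Fintype A] (P : TransitionKernel A) : Prop :=
  ∃ C α : ℝ, 0 < C ∧ 0 < α ∧ ∀ k : ℕ, 1 ≤ k → supContRate P k ≤ C * Real.exp (-α * k)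

/-- A finite partition of `Ω` into events of the σ-algebra `m`. -/
structure IsFinPartition {Ω : Type*} (m : MeasurableSpace Ω) {I : ℕ} (E : Fin I → Set Ω) :
    Prop where
  measurableSet : ∀ i, MeasurableSet[m] (E i)
  disjoint : Pairwise (Function.onFun Disjoint E)
  iUnion_eq : ⋃ i, E i = Set.univ

/-- The set of the sums `∑ i, ∑ j, |μ(E i ∩ F j) - μ(E i) μ(F j)|` over all pairs of finite
partitions `E`, `F` of `Ω` that are measurable for `m₁`, `m₂`. -/
def betaSums {Ω : Type*} (m₁ m₂ : MeasurableSpace Ω) [MeasurableSpace Ω] (μ : Measure Ω) :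
    Set ℝ :=
  {s | ∃ (I J : ℕ) (E : Fin I → Set Ω) (F : Fin J → Set Ω),
    IsFinPartition m₁ E ∧ IsFinPartition m₂ F ∧
      s = ∑ i, ∑ j, |μ.real (E i ∩ F j) - μ.real (E i) * μ.real (F j)|}

/-- The `β`-mixing coefficient of two σ-algebras. -/
def betaCoeff {Ω : Type*} (m₁ m₂ : MeasurableSpace Ω) [MeasurableSpace Ω] (μ : Measure Ω) : ℝ :=
  (1 / 2) * sSup (betaSums m₁ m₂ μ)

lemma IsFinPartition.sum_real_inter {Ω : Type*} {m : MeasurableSpace Ω}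
    [m0 : MeasurableSpace Ω] {μ : Measure Ω} [IsProbabilityMeasure μ] (hm : m ≤ m0) {I : ℕ} {E : Fin I → Set Ω}
    (hE : IsFinPartition m E) {S : Set Ω} (hS : MeasurableSet[m0] S) :
    ∑ i, μ.real (S ∩ E i) = μ.real S := by
  rw [← measureReal_iUnion_fintype
    (fun i j hij => (hE.disjoint hij).mono Set.inter_subset_right Set.inter_subset_right)
    (fun i => hS.inter (hm _ (hE.measurableSet i))),
    ← Set.inter_iUnion, hE.iUnion_eq, Set.inter_univ]

/-- The supremum defining `betaCoeff` is over a nonempty bounded set. -/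
lemma betaSums_nonempty_bddAbove {Ω : Type*} {m₁ m₂ : MeasurableSpace Ω}
    [m0 : MeasurableSpace Ω] (μ : Measure Ω) [IsProbabilityMeasure μ] (h₁ : m₁ ≤ m0) (h₂ : m₂ ≤ m0) :
    (betaSums m₁ m₂ μ).Nonempty ∧ BddAbove (betaSums m₁ m₂ μ) := by
  have triv : ∀ m : MeasurableSpace Ω, IsFinPartition m (fun _ : Fin 1 => Set.univ) := fun m =>
    ⟨fun _ => MeasurableSet.univ, fun i j hij => (hij (Subsingleton.elim i j)).elim,
      Set.iUnion_const _⟩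
  refine ⟨⟨_, 1, 1, _, _, triv m₁, triv m₂, rfl⟩, 2, ?_⟩
  rintro _ ⟨I, J, E, F, hE, hF, rfl⟩
  have hE1 : ∑ i, μ.real (E i) = 1 := by
    simpa using hE.sum_real_inter (μ := μ) h₁ MeasurableSet.univ
  have hF1 : ∑ j, μ.real (F j) = 1 := by
    simpa using hF.sum_real_inter (μ := μ) h₂ MeasurableSet.univ
  calc ∑ i, ∑ j, |μ.real (E i ∩ F j) - μ.real (E i) * μ.real (F j)|
      ≤ ∑ i, ∑ j, (μ.real (E i ∩ F j) + μ.real (E i) * μ.real (F j)) := by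
        refine Finset.sum_le_sum fun i _ => Finset.sum_le_sum fun j _ => ?_
        have a1 : 0 ≤ μ.real (E i ∩ F j) := measureReal_nonneg
        have a2 : 0 ≤ μ.real (E i) * μ.real (F j) := mul_nonneg measureReal_nonneg measureReal_nonneg
        rw [abs_le]
        constructor <;> linarith
    _ = 2 := by
        simp_rw [Finset.sum_add_distrib, ← Finset.mul_sum, hF1, mul_one,
          hF.sum_real_inter h₂ (h₁ _ (hE.measurableSet _)), hE1]
        norm_num

/-- `β_k`, the `β`-mixing coefficient of `σ(X_i, i ≤ 0)` and `σ(X_i, i ≥ k)`. -/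
def beta {Ω A : Type*} [MeasurableSpace Ω] [MeasurableSpace A] (X : ℤ → Ω → A) (μ : Measure Ω)
    (k : ℕ) : ℝ :=
  betaCoeff (sigmaOf X (Set.Iic 0)) (sigmaOf X (Set.Ici (k : ℤ))) μ

/-- The process is geometrically (`β`-)mixing. -/
def GMC {Ω A : Type*} [MeasurableSpace Ω] [MeasurableSpace A] (X : ℤ → Ω → A) (μ : Measure Ω) :
    Prop :=
  ∃ L γ : ℝ, 0 < L ∧ 0 < γ ∧ ∀ k : ℕ, beta X μ k ≤ L * Real.exp (-γ * k)

end ChainMixing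

end

/-! Let `T` be the transfer operator of the kernel, `(T f)(w) = ∑ a, P(a | w) f(w a)`, and let `ν`
be the law of the past. Compatibility and stationarity make `T` dual to forgetting the newest
letter: `∫ f dν` over `tail^[n] ⁻¹' B` equals `∫ T^n f dν` over `B`. If `T^n f` is nearly constant,
`f` is therefore nearly uncorrelated with every event that lies `n` letters back, so mixing reduces
to loss of memory for `T`.

Loss of memory combines two effects. By compactness the positive continuous probabilities are at
least some `p > 0`, so two pasts can be given the same next letter with weight `|A| p`. By
exponential continuity, Hölder bounds survive `T` (a Doeblin–Fortet inequality), so pasts that have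
received enough common letters give values differing by at most half the oscillation scale. Hence a
fixed power of `T` contracts oscillation and Hölder constant together
(`exists_isRegular_contraction`).

The bound must not depend on the number `r` of future letters observed. This holds because `T^r f`
has a Hölder constant independent of `r` when `f` reads `r` letters (`HasRate.holder_iterate`).
Cylinders then approximate all future events, and a bound proportional to the probability of the
past event sums over partitions (`betaCoeff_le`). -/

noncomputable section

namespace ChainMixing

/-! ### Pasts, their agreement, and weighted sums. -/

section Transfer

variable {A : Type*}

/-- The pasts `w` and `w'` have the same `j` most recent letters. -/
def Agree (j : ℕ) (w w' : ℕ → A) : Prop := ∀ i < j, w i = w' i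

/-- The past obtained from `w` by appending the letter `a`. -/
def snoc (a : A) (w : ℕ → A) : ℕ → A
  | 0 => a
  | n + 1 => w n

/-- The past obtained from `w` by deleting the most recent letter. -/
def tail (w : ℕ → A) : ℕ → A := fun n => w (n + 1)

lemma Agree.mono {i j : ℕ} {w w' : ℕ → A} (h : Agree j w w') (hij : i ≤ j) : Agree i w w' :=
  fun n hn => h n (hn.trans_le hij)

lemma Agree.snoc {j : ℕ} {w w' : ℕ → A} (h : Agree j w w') (a : A) :
    Agree (j + 1) (snoc a w) (snoc a w') := by
  intro i hi
  cases i with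
  | zero => rfl
  | succ i => exact h i (by omega)

lemma graft_of_agree {j : ℕ} {w w' : ℕ → A} (h : Agree j w w') : graft j w w' = w' := by
  funext i
  unfold graft
  split_ifs with hi
  · exact h i hi
  · rfl

lemma graft_self (j : ℕ) (w : ℕ → A) : graft j w w = w :=
  graft_of_agree fun _ _ => rfl

/-- A function whose values at pasts with `j` common recent letters are close is continuous. -/
lemma continuous_of_agree [TopologicalSpace A] [DiscreteTopology A] {f : (ℕ → A) → ℝ}
    (h : ∀ ε > 0, ∃ j, ∀ w w', Agree j w w' → |f w - f w'| < ε) : Continuous f := by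
  rw [continuous_iff_continuousAt]
  intro w
  rw [ContinuousAt, Metric.tendsto_nhds]
  intro ε hε
  obtain ⟨j, hj⟩ := h ε hε
  filter_upwards [(PiNat.isOpen_cylinder (fun _ : ℕ => A) w j).mem_nhds
    (PiNat.self_mem_cylinder w j)] with v hv
  exact hj v w hv

lemma measurable_snoc [MeasurableSpace A] (a : A) : Measurable (snoc a) := by
  refine measurable_pi_lambda _ fun n => ?_
  cases n with
  | zero => exact measurable_const
  | succ n => exact measurable_pi_apply n

lemma measurable_tail [MeasurableSpace A] : Measurable (tail (A := A)) :=
  measurable_pi_lambda _ fun n => measurable_pi_apply (n + 1)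

variable [Fintype A]

/-- Two weighted sums with the same total weight `s` differ by at most `s * c` if all the differences
of the summed values are at most `c`. -/
lemma sum_mul_sub_sum_mul_le {u v x y : A → ℝ} {s c : ℝ} (hu : ∀ a, 0 ≤ u a)
    (hv : ∀ a, 0 ≤ v a) (hus : ∑ a, u a = s) (hvs : ∑ a, v a = s)
    (hxy : ∀ a b, x a - y b ≤ c) : ∑ a, u a * x a - ∑ a, v a * y a ≤ s * c := by
  rcases isEmpty_or_nonempty A with hA | hA
  · simp at hus ⊢
    simp [← hus]
  obtain ⟨a, ha⟩ := Finite.exists_max x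
  obtain ⟨b, hb⟩ := Finite.exists_min y
  have h1 : ∑ i, u i * x i ≤ s * x a := by
    rw [← hus, Finset.sum_mul]
    exact Finset.sum_le_sum fun i _ => mul_le_mul_of_nonneg_left (ha i) (hu i)
  have h2 : s * y b ≤ ∑ i, v i * y i := by
    rw [← hvs, Finset.sum_mul]
    exact Finset.sum_le_sum fun i _ => mul_le_mul_of_nonneg_left (hb i) (hv i)
  have hs : 0 ≤ s := hus ▸ Finset.sum_nonneg fun i _ => hu i
  have := mul_le_mul_of_nonneg_left (hxy a b) hs
  linarith

/-! ### The transfer operator and loss of memory. -/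

namespace TransitionKernel

variable (P : TransitionKernel A)

/-- The operator `(T f)(w) = ∑ a, P(a | w) f(w a)`. -/
def transfer (f : (ℕ → A) → ℝ) : (ℕ → A) → ℝ := fun w => ∑ a, P.prob w a * f (snoc a w)

lemma transfer_mem_Icc {f : (ℕ → A) → ℝ} (hf : ∀ w, f w ∈ Set.Icc (0 : ℝ) 1) (w : ℕ → A) :
    P.transfer f w ∈ Set.Icc (0 : ℝ) 1 := by
  constructor
  · exact Finset.sum_nonneg fun a _ => mul_nonneg (P.prob_mem w a).1 (hf _).1
  · calc P.transfer f w ≤ ∑ a, P.prob w a * 1 :=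
          Finset.sum_le_sum fun a _ => mul_le_mul_of_nonneg_left (hf _).2 (P.prob_mem w a).1
      _ = 1 := by simp [P.sum_prob]

lemma iterate_transfer_mem_Icc {f : (ℕ → A) → ℝ} (hf : ∀ w, f w ∈ Set.Icc (0 : ℝ) 1) (n : ℕ) :
    ∀ w, P.transfer^[n] f w ∈ Set.Icc (0 : ℝ) 1 := by
  induction n with
  | zero => exact hf
  | succ n ih =>
    rw [Function.iterate_succ_apply']
    exact P.transfer_mem_Icc ih

/-- If all the transition probabilities are at least `p`, then with weight `|A| p` the same letter
is appended to both pasts. -/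
lemma abs_transfer_sub_le_of_le {f : (ℕ → A) → ℝ} {p h c : ℝ} (hp : 0 ≤ p)
    (hP : ∀ w a, p ≤ P.prob w a) (hc : ∀ w w', |f w - f w'| ≤ c) {w w' : ℕ → A}
    (hh : ∀ a, |f (snoc a w) - f (snoc a w')| ≤ h) :
    |P.transfer f w - P.transfer f w'|
      ≤ Fintype.card A * p * h + (1 - Fintype.card A * p) * c := by
  have key : ∀ w w', (∀ a, |f (snoc a w) - f (snoc a w')| ≤ h) →
      P.transfer f w - P.transfer f w'
        ≤ Fintype.card A * p * h + (1 - Fintype.card A * p) * c := by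
    intro w w' hh
    -- With the common weight `p` per letter removed, both residual weights are nonnegative of equal
    -- mass, and only they pay the full oscillation `c`.
    have hs : ∀ w, ∑ a, (P.prob w a - p) = 1 - Fintype.card A * p := fun w => by
      simp [Finset.sum_sub_distrib, P.sum_prob]
    have h1 := sum_mul_sub_sum_mul_le (x := fun a => f (snoc a w)) (y := fun a => f (snoc a w'))
      (fun a => sub_nonneg.2 (hP w a)) (fun a => sub_nonneg.2 (hP w' a)) (hs w) (hs w')
      (fun a b => (le_abs_self _).trans (hc _ _))
    have h2 : ∑ a, p * (f (snoc a w) - f (snoc a w')) ≤ ∑ _a : A, p * h :=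
      Finset.sum_le_sum fun a _ => mul_le_mul_of_nonneg_left ((le_abs_self _).trans (hh a)) hp
    rw [Finset.sum_const, Finset.card_univ, nsmul_eq_mul] at h2
    have h3 : P.transfer f w - P.transfer f w' = ∑ a, p * (f (snoc a w) - f (snoc a w'))
        + (∑ a, (P.prob w a - p) * f (snoc a w) - ∑ a, (P.prob w' a - p) * f (snoc a w')) := by
      simp only [transfer]
      rw [← Finset.sum_sub_distrib, ← Finset.sum_sub_distrib, ← Finset.sum_add_distrib]
      exact Finset.sum_congr rfl fun a _ => by ring
    rw [h3]
    linarith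
  rw [abs_le]
  have := key w' w fun a => by rw [abs_sub_comm]; exact hh a
  constructor
  · linarith
  · exact key w w' hh

lemma abs_transfer_sub_le {f : (ℕ → A) → ℝ} {c : ℝ} (hc : ∀ w w', |f w - f w'| ≤ c)
    (w w' : ℕ → A) : |P.transfer f w - P.transfer f w'| ≤ c := by
  simpa using P.abs_transfer_sub_le_of_le le_rfl (fun w a => (P.prob_mem w a).1) hc
    (fun a => hc (snoc a w) (snoc a w'))

lemma abs_iterate_transfer_sub_le {f : (ℕ → A) → ℝ} {c : ℝ} (hc : ∀ w w', |f w - f w'| ≤ c)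
    (n : ℕ) : ∀ w w', |P.transfer^[n] f w - P.transfer^[n] f w'| ≤ c := by
  induction n with
  | zero => exact hc
  | succ n ih =>
    rw [Function.iterate_succ_apply']
    exact P.abs_transfer_sub_le ih

/-- The variation of `T f` in terms of those of `f` and of the transition probabilities. -/
lemma abs_transfer_sub_le_add {f : (ℕ → A) → ℝ} {h c d : ℝ} (hc : ∀ w w', |f w - f w'| ≤ c)
    {w w' : ℕ → A} (hh : ∀ a, |f (snoc a w) - f (snoc a w')| ≤ h)
    (hd : ∑ a, |P.prob w a - P.prob w' a| ≤ d) :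
    |P.transfer f w - P.transfer f w'| ≤ h + d * c := by
  have hc0 : 0 ≤ c := (abs_nonneg _).trans (hc w w')
  -- The kernel differences sum to zero, so any constant may be subtracted from `f`; the choice `f
  -- w'` makes oscillation replace size.
  have h0 : P.transfer f w - P.transfer f w' = ∑ a, P.prob w a * (f (snoc a w) - f (snoc a w'))
      + ∑ a, (P.prob w a - P.prob w' a) * (f (snoc a w') - f w') := by
    have : ∑ a, (P.prob w a - P.prob w' a) * f w' = 0 := by
      rw [← Finset.sum_mul, Finset.sum_sub_distrib, P.sum_prob, P.sum_prob, sub_self, zero_mul]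
    rw [← sub_zero (P.transfer f w - P.transfer f w'), ← this]
    simp only [transfer]
    rw [← Finset.sum_sub_distrib, ← Finset.sum_sub_distrib, ← Finset.sum_add_distrib]
    exact Finset.sum_congr rfl fun a _ => by ring
  rw [h0]
  refine (abs_add_le _ _).trans (add_le_add ?_ ?_)
  · calc _ ≤ ∑ a, |P.prob w a * (f (snoc a w) - f (snoc a w'))| := Finset.abs_sum_le_sum_abs _ _
      _ ≤ ∑ a, P.prob w a * h := Finset.sum_le_sum fun a _ => by
          rw [abs_mul, abs_of_nonneg (P.prob_mem w a).1]
          exact mul_le_mul_of_nonneg_left (hh a) (P.prob_mem w a).1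
      _ = h := by rw [← Finset.sum_mul, P.sum_prob, one_mul]
  · calc _ ≤ ∑ a, |(P.prob w a - P.prob w' a) * (f (snoc a w') - f w')| :=
          Finset.abs_sum_le_sum_abs _ _
      _ ≤ ∑ a, |P.prob w a - P.prob w' a| * c := Finset.sum_le_sum fun a _ => by
          rw [abs_mul]
          exact mul_le_mul_of_nonneg_left (hc _ _) (abs_nonneg _)
      _ ≤ d * c := by
          rw [← Finset.sum_mul]
          exact mul_le_mul_of_nonneg_right hd hc0

/-- The variations of the transition probabilities decay geometrically. -/
def HasRate (D θ : ℝ) : Prop :=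
  ∀ j w w', Agree j w w' → ∑ a, |P.prob w a - P.prob w' a| ≤ D * θ ^ j

variable {P}

/-- A function with oscillation at most `c` that is Hölder continuous with constant `c * M`. -/
structure IsRegular (M θ c : ℝ) (f : (ℕ → A) → ℝ) : Prop where
  osc : ∀ w w', |f w - f w'| ≤ c
  holder : ∀ j w w', Agree j w w' → |f w - f w'| ≤ c * (M * θ ^ j)

/-- Doeblin–Fortet step: the appended letter lengthens the agreement by one, which gains a factor
`θ` on the variation of `f`, while the change of kernel costs `D * θ ^ j` times the oscillation. -/
lemma HasRate.holder_transfer {D θ M ρ c : ℝ} (hD : P.HasRate D θ) (hθ : 0 ≤ θ)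
    (hM : θ * M + D ≤ ρ * M) {f : (ℕ → A) → ℝ} (hosc : ∀ w w', |f w - f w'| ≤ c) {j : ℕ}
    (hf : ∀ w w', Agree (j + 1) w w' → |f w - f w'| ≤ c * (M * θ ^ (j + 1)))
    {w w' : ℕ → A} (hw : Agree j w w') :
    |P.transfer f w - P.transfer f w'| ≤ ρ * c * (M * θ ^ j) := by
  have hc0 : 0 ≤ c := (abs_nonneg _).trans (hosc w w')
  refine (P.abs_transfer_sub_le_add hosc (fun a => hf _ _ (hw.snoc a)) (hD j w w' hw)).trans ?_
  have := mul_le_mul_of_nonneg_right hM (mul_nonneg hc0 (pow_nonneg hθ j))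
  calc _ = (θ * M + D) * (c * θ ^ j) := by ring
    _ ≤ ρ * M * (c * θ ^ j) := this
    _ = _ := by ring

/-- Each application of `T` tests `f` on one more common letter, so the restriction `r ≤ j` weakens
by one per step and is void after `r` steps. -/
lemma HasRate.holder_iterate {D θ M c : ℝ} (hD : P.HasRate D θ) (hθ : 0 ≤ θ)
    (hM : θ * M + D ≤ M) {f : (ℕ → A) → ℝ} (hosc : ∀ w w', |f w - f w'| ≤ c) {r : ℕ}
    (hf : ∀ j w w', r ≤ j → Agree j w w' → |f w - f w'| ≤ c * (M * θ ^ j)) (n : ℕ) :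
    ∀ j w w', r ≤ j + n → Agree j w w' →
      |P.transfer^[n] f w - P.transfer^[n] f w'| ≤ c * (M * θ ^ j) := by
  induction n with
  | zero => exact hf
  | succ n ih =>
    intro j w w' hj hw
    rw [Function.iterate_succ_apply']
    simpa using hD.holder_transfer hθ (ρ := 1) (by simpa using hM)
      (P.abs_iterate_transfer_sub_le hosc n) (fun v v' hv => ih (j + 1) v v' (by omega) hv) hw

lemma IsRegular.iterate {D θ M c : ℝ} (hD : P.HasRate D θ) (hθ : 0 ≤ θ)
    (hM : θ * M + D ≤ M) {f : (ℕ → A) → ℝ} (hf : IsRegular M θ c f) (n : ℕ) :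
    IsRegular M θ c (P.transfer^[n] f) :=
  ⟨P.abs_iterate_transfer_sub_le hf.osc n, fun j w w' hw =>
    hD.holder_iterate hθ hM hf.osc (r := 0) (fun j w w' _ => hf.holder j w w') n j w w'
      (Nat.zero_le _) hw⟩

/-- The probability of appending the same `n` letters to both pasts makes the oscillation smaller. -/
lemma IsRegular.abs_iterate_sub_le {θ M c p : ℝ} (hp : 0 ≤ p) (hP : ∀ w a, p ≤ P.prob w a)
    {f : (ℕ → A) → ℝ} (hf : IsRegular M θ c f) (n : ℕ) :
    ∀ j w w', Agree j w w' → |P.transfer^[n] f w - P.transfer^[n] f w'|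
      ≤ c * (1 - (Fintype.card A * p) ^ n * (1 - M * θ ^ (j + n))) := by
  induction n with
  | zero => simpa using hf.holder
  | succ n ih =>
    intro j w w' hw
    rw [Function.iterate_succ_apply']
    refine (P.abs_transfer_sub_le_of_le hp hP (P.abs_iterate_transfer_sub_le hf.osc n)
      (fun a => ih (j + 1) _ _ (hw.snoc a))).trans_eq ?_
    rw [show j + (n + 1) = j + 1 + n by omega]
    ring

/-- Some power of the transfer operator is a contraction for the regularity constants. -/
lemma exists_isRegular_contraction {D θ p : ℝ} (hD : P.HasRate D θ) (hD0 : 0 ≤ D) (hθ : 0 < θ)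
    (hθ1 : θ < 1) (hp : 0 < p) (hP : ∀ w a, p ≤ P.prob w a) [Nonempty A] :
    ∃ (M r : ℝ) (N : ℕ), 0 ≤ M ∧ θ * M + D ≤ M ∧ 0 < r ∧ r < 1 ∧ 0 < N ∧
      ∀ c f, IsRegular M θ c f → IsRegular M θ (r * c) (P.transfer^[N] f) := by
  have hθ' : 0 < 1 - θ := sub_pos.2 hθ1
  -- This choice gives `θ * M + D = (1 + θ) / 2 * M`, leaving room for a strict contraction of the
  -- Hölder constant.
  set M : ℝ := 2 * D / (1 - θ) with hMdef
  have hM0 : 0 ≤ M := by positivity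
  have hDM : 2 * D = M * (1 - θ) := by rw [hMdef]; field_simp
  have hM : θ * M + D ≤ M := by nlinarith
  have hMρ : θ * M + D ≤ (1 + θ) / 2 * M := by nlinarith
  obtain ⟨n, hn⟩ : ∃ n : ℕ, M * θ ^ (n + 1) ≤ 1 / 2 := by
    have : Filter.Tendsto (fun n : ℕ => M * θ ^ (n + 1)) Filter.atTop (nhds 0) := by
      simpa using ((tendsto_pow_atTop_nhds_zero_of_lt_one hθ.le hθ1).comp
        (Filter.tendsto_add_atTop_nat 1)).const_mul M
    exact (this.eventually (ge_mem_nhds (by norm_num))).exists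
  set q : ℝ := Fintype.card A * p with hq
  have hq0 : 0 < q := mul_pos (by exact_mod_cast Fintype.card_pos) hp
  have hqn : 0 < q ^ (n + 1) := pow_pos hq0 _
  -- The second rate is for the oscillation, which uses all `n + 1` common letters; the first is for
  -- the Hölder constant, which already contracts in the last step alone.
  refine ⟨M, max ((1 + θ) / 2) (1 - q ^ (n + 1) / 2), n + 1, hM0, hM, lt_max_of_lt_left (by linarith),
    max_lt (by linarith) (by linarith), Nat.succ_pos n, fun c f hf => ?_⟩
  have hc0 : 0 ≤ c := (abs_nonneg _).trans
    (hf.osc (fun _ => Classical.arbitrary A) (fun _ => Classical.arbitrary A))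
  constructor
  · intro w w'
    refine (hf.abs_iterate_sub_le hp.le hP (n + 1) 0 w w' fun i hi => absurd hi (by omega)).trans ?_
    rw [mul_comm _ c, zero_add, ← hq]
    refine mul_le_mul_of_nonneg_left (le_max_of_le_right ?_) hc0
    nlinarith
  · intro j w w' hw
    rw [Function.iterate_succ_apply']
    have hreg := hf.iterate hD hθ.le hM n
    refine (hD.holder_transfer hθ.le hMρ hreg.osc (fun v v' => hreg.holder _ v v') hw).trans ?_
    have : 0 ≤ M * θ ^ j := by positivity
    gcongr
    exact le_max_left _ _

/-- Rounding `k / N` down costs at most one factor `r⁻¹`. -/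
lemma exists_exp_bound {r : ℝ} (hr : 0 < r) (hr1 : r < 1) {N : ℕ} (hN : 0 < N) :
    ∃ L γ : ℝ, 0 < L ∧ 0 < γ ∧ ∀ k : ℕ, r ^ (k / N) ≤ L * Real.exp (-γ * k) := by
  have hlog : Real.log r < 0 := Real.log_neg hr hr1
  have hN' : (0 : ℝ) < N := by exact_mod_cast hN
  refine ⟨r⁻¹, -Real.log r / N, by positivity, div_pos (neg_pos.2 hlog) hN', fun k => ?_⟩
  have hk : (k : ℝ) ≤ N * ((k / N : ℕ) : ℝ) + N := by
    exact_mod_cast (by have := Nat.lt_mul_div_succ k hN; rw [mul_add] at this; omega :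
      k ≤ N * (k / N) + N)
  have hk' : (k : ℝ) / N ≤ ((k / N : ℕ) : ℝ) + 1 := by
    rw [div_le_iff₀ hN']; linarith
  calc r ^ (k / N) = Real.exp (Real.log r * (k / N : ℕ)) := by
        rw [mul_comm, Real.exp_nat_mul, Real.exp_log hr]
    _ ≤ Real.exp (-Real.log r + -(-Real.log r / N) * k) := by
        apply Real.exp_le_exp.2
        have := mul_le_mul_of_nonpos_left hk' hlog.le
        calc _ ≤ -Real.log r + Real.log r * (k / N) := by linarith
          _ = _ := by ring
    _ = _ := by rw [Real.exp_add, Real.exp_neg, Real.exp_log hr]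

/-- Loss of memory: the oscillation of `T^(k+r) f`, for `f` a function of the `r` most recent letters
with values in `[0, 1]`, is exponentially small in `k`, uniformly in `r` and `f`. -/
theorem exists_osc_iterate_le {D θ p : ℝ} (hD : P.HasRate D θ) (hD0 : 0 ≤ D) (hθ : 0 < θ)
    (hθ1 : θ < 1) (hp : 0 < p) (hP : ∀ w a, p ≤ P.prob w a) [Nonempty A] :
    ∃ L γ : ℝ, 0 < L ∧ 0 < γ ∧ ∀ (k r : ℕ) (f : (ℕ → A) → ℝ), (∀ w, f w ∈ Set.Icc (0 : ℝ) 1) →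
      (∀ w w', Agree r w w' → f w = f w') →
      ∀ w w', |P.transfer^[k + r] f w - P.transfer^[k + r] f w'| ≤ L * Real.exp (-γ * k) := by
  obtain ⟨M, ρ, N, hM0, hM, hρ, hρ1, hN, hcontr⟩ :=
    exists_isRegular_contraction hD hD0 hθ hθ1 hp hP
  obtain ⟨L, γ, hL, hγ, hbound⟩ := exists_exp_bound hρ hρ1 hN
  refine ⟨L, γ, hL, hγ, fun k r f hf hfr w w' => ?_⟩
  have hosc : ∀ w w', |f w - f w'| ≤ 1 := fun w w' =>
    abs_sub_le_of_nonneg_of_le (hf w).1 (hf w).2 (hf w').1 (hf w').2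
  have hreg : IsRegular M θ 1 (P.transfer^[r] f) := by
    refine ⟨P.abs_iterate_transfer_sub_le hosc r, fun j w w' hw =>
      hD.holder_iterate hθ.le hM hosc (r := r) (fun j w w' hj hw => ?_) r j w w' (by omega) hw⟩
    -- For `j ≥ r` the variation of `f` vanishes, whatever `r` is.
    rw [hfr w w' (hw.mono hj), sub_self, abs_zero]
    positivity
  have hpow : ∀ m, IsRegular M θ (ρ ^ m) (P.transfer^[N * m] (P.transfer^[r] f)) := by
    intro m
    induction m with
    | zero => simpa using hreg
    | succ m ih =>
      rw [pow_succ', mul_add, mul_one, add_comm, Function.iterate_add_apply]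
      exact hcontr _ _ ih
  -- The `k % N` leftover steps do not increase the oscillation.
  rw [Function.iterate_add_apply, ← Nat.mod_add_div k N, Function.iterate_add_apply,
    Nat.mod_add_div k N]
  exact (P.abs_iterate_transfer_sub_le (hpow (k / N)).osc _ w w').trans (hbound k)

/-! ### Regularity and positivity of the kernel. -/

/-- Exponential decay of the continuity rates bounds the variations of the probabilities. -/
lemma exists_hasRate (hε : ExpContinuityDecay P) :
    ∃ D θ : ℝ, P.HasRate D θ ∧ 0 ≤ D ∧ 0 < θ ∧ θ < 1 := by
  obtain ⟨C, α, hC, hα, h⟩ := hε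
  -- The rate hypothesis starts at `k = 1`; the extra `1` covers `j = 0` by the trivial bound.
  refine ⟨Fintype.card A * (C + 1), Real.exp (-α), ?_, by positivity, Real.exp_pos _,
    by simpa using hα⟩
  intro j w w' hw
  have hb : ∀ a, |P.prob w a - P.prob w' a| ≤ (C + 1) * Real.exp (-α) ^ j := by
    intro a
    rcases Nat.eq_zero_or_pos j with rfl | hj
    · have := abs_prob_sub_le_one P w w' a
      simp
      linarith
    · have h1 : |P.prob w a - P.prob w' a| ≤ contRate P j w a := by
        have := le_ciSup (bddAbove_contRate P j w a) (w, w')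
        simpa only [contRate, graft_self, graft_of_agree hw] using this
      have h2 : contRate P j w a ≤ supContRate P j :=
        le_ciSup (bddAbove_supContRate P j) (w, a)
      have h3 := h j hj
      rw [show Real.exp (-α * j) = Real.exp (-α) ^ j by rw [mul_comm, Real.exp_nat_mul]] at h3
      have : 0 ≤ Real.exp (-α) ^ j := by positivity
      linarith
  calc _ ≤ ∑ _a : A, (C + 1) * Real.exp (-α) ^ j := Finset.sum_le_sum fun a _ => hb a
    _ = _ := by rw [Finset.sum_const, Finset.card_univ, nsmul_eq_mul]; ring

lemma HasRate.continuous [TopologicalSpace A] [DiscreteTopology A] {D θ : ℝ}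
    (hD : P.HasRate D θ) (hθ : 0 < θ) (hθ1 : θ < 1) (a : A) : Continuous fun w => P.prob w a := by
  refine continuous_of_agree fun ε hε => ?_
  have : Filter.Tendsto (fun j : ℕ => D * θ ^ j) Filter.atTop (nhds 0) := by
    simpa using (tendsto_pow_atTop_nhds_zero_of_lt_one hθ.le hθ1).const_mul D
  obtain ⟨j, hj⟩ := (this.eventually (gt_mem_nhds hε)).exists
  refine ⟨j, fun w w' hw => lt_of_le_of_lt ?_ hj⟩
  exact (Finset.single_le_sum (f := fun a => |P.prob w a - P.prob w' a|)
    (fun a _ => abs_nonneg _) (Finset.mem_univ a)).trans (hD j w w' hw)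

/-- By compactness, positive continuous transition probabilities are bounded away from zero. -/
lemma exists_pos_le_prob [TopologicalSpace A] [DiscreteTopology A] [Nonempty A]
    (hP : ∀ a, Continuous fun w => P.prob w a) (hRC : RC P) :
    ∃ p : ℝ, 0 < p ∧ ∀ w a, p ≤ P.prob w a := by
  have h : ∀ a, ∃ w₀, ∀ w, P.prob w₀ a ≤ P.prob w a := fun a => by
    obtain ⟨w₀, -, hw₀⟩ := isCompact_univ.exists_isMinOn Set.univ_nonempty (hP a).continuousOn
    exact ⟨w₀, fun w => hw₀ (Set.mem_univ w)⟩
  choose w₀ hw₀ using h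
  obtain ⟨b, hb⟩ := Finite.exists_min fun a => P.prob (w₀ a) a
  exact ⟨_, hRC b (w₀ b), fun w a => (hb a).trans (hw₀ a w)⟩

end TransitionKernel

end Transfer

/-! ### Past and future windows of the process. -/

section Law

variable {Ω A : Type*}

/-- The sequence `X_n, X_{n-1}, …`. -/
def pastAt (X : ℤ → Ω → A) (n : ℤ) (ω : Ω) : ℕ → A := fun j => X (n - j) ω

/-- The sequence `X_n, X_{n+1}, …`. -/
def futureAt (X : ℤ → Ω → A) (n : ℤ) (ω : Ω) : ℕ → A := fun j => X (n + j) ω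

lemma iterate_tail_apply (m : ℕ) (w : ℕ → A) (j : ℕ) : tail^[m] w j = w (m + j) := by
  induction m generalizing w with
  | zero => simp
  | succ m ih =>
    rw [Function.iterate_succ_apply, ih]
    exact congrArg w (by omega)

lemma iterate_tail_pastAt (X : ℤ → Ω → A) (n : ℤ) (m : ℕ) (ω : Ω) :
    tail^[m] (pastAt X (n + m) ω) = pastAt X n ω := by
  funext j
  rw [iterate_tail_apply]
  simp only [pastAt]
  congr 1
  push_cast
  ring

lemma snoc_pastAt (X : ℤ → Ω → A) (ω : Ω) :
    snoc (X 0 ω) (pastAt X (-1) ω) = pastAt X 0 ω := by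
  funext j
  cases j with
  | zero => simp [snoc, pastAt]
  | succ j =>
    simp only [snoc, pastAt]
    congr 1
    push_cast
    ring

variable [MeasurableSpace A]

lemma measurable_iterate_tail (m : ℕ) : Measurable (tail (A := A))^[m] :=
  measurable_tail.iterate m

lemma measurable_sigmaOf (X : ℤ → Ω → A) {S : Set ℤ} {i : ℤ} (hi : i ∈ S) :
    Measurable[sigmaOf X S] (X i) := by
  have h : MeasurableSpace.comap (X i) inferInstance ≤ sigmaOf X S :=
    le_iSup₂ (f := fun i (_ : i ∈ S) => MeasurableSpace.comap (X i) inferInstance) i hi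
  exact Measurable.mono (comap_measurable (X i)) h le_rfl

lemma measurable_pastAt_sigmaOf (X : ℤ → Ω → A) (n : ℤ) :
    Measurable[sigmaOf X (Set.Iic n)] (pastAt X n) :=
  @measurable_pi_lambda _ _ _ (sigmaOf X (Set.Iic n)) _ _
    fun j => measurable_sigmaOf X (by simp)

lemma sigmaOf_Iic_le (X : ℤ → Ω → A) (n : ℤ) :
    sigmaOf X (Set.Iic n) ≤ MeasurableSpace.comap (pastAt X n) inferInstance := by
  refine iSup₂_le fun i hi => ?_
  have : X i = (fun w : ℕ → A => w (n - i).toNat) ∘ pastAt X n := by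
    funext ω
    simp only [Function.comp, pastAt]
    congr 1
    have := Set.mem_Iic.1 hi
    omega
  rw [this, ← MeasurableSpace.comap_comp]
  exact MeasurableSpace.comap_mono (measurable_pi_apply _).comap_le

lemma sigmaOf_Ici_le (X : ℤ → Ω → A) (n : ℤ) :
    sigmaOf X (Set.Ici n) ≤ MeasurableSpace.comap (futureAt X n) inferInstance := by
  refine iSup₂_le fun i hi => ?_
  have : X i = (fun w : ℕ → A => w (i - n).toNat) ∘ futureAt X n := by
    funext ω
    simp only [Function.comp, futureAt]
    congr 1
    have := Set.mem_Ici.1 hi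
    omega
  rw [this, ← MeasurableSpace.comap_comp]
  exact MeasurableSpace.comap_mono (measurable_pi_apply _).comap_le

variable [MeasurableSpace Ω] {X : ℤ → Ω → A} {μ : Measure Ω}

lemma sigmaOf_le (hX : ∀ n, Measurable (X n)) (S : Set ℤ) :
    sigmaOf X S ≤ (inferInstance : MeasurableSpace Ω) :=
  iSup₂_le fun i _ => (hX i).comap_le

lemma measurable_pastAt (hX : ∀ n, Measurable (X n)) (n : ℤ) : Measurable (pastAt X n) :=
  measurable_pi_lambda _ fun _ => hX _

lemma measurable_futureAt (hX : ∀ n, Measurable (X n)) (n : ℤ) : Measurable (futureAt X n) :=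
  measurable_pi_lambda _ fun _ => hX _

lemma IsStationaryErgodic.map_pastAt (hX : IsStationaryErgodic X μ) (n : ℤ) :
    μ.map (pastAt X n) = μ.map (pastAt X 0) := by
  have hXm : Measurable fun ω n => X n ω := measurable_pi_lambda _ hX.measurable
  have hpr : ∀ n : ℤ, Measurable fun (x : ℤ → A) (j : ℕ) => x (n - j) := fun n =>
    measurable_pi_lambda _ fun j => measurable_pi_apply _
  have hmp := hX.ergodic.toMeasurePreserving
  have step : ∀ n : ℤ, μ.map (pastAt X (n + 1)) = μ.map (pastAt X n) := by
    intro n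
    have h1 : μ.map (pastAt X n) = (μ.map fun ω n => X n ω).map fun x (j : ℕ) => x (n - j) := by
      rw [Measure.map_map (hpr n) hXm]; rfl
    rw [h1, ← hmp.map_eq, Measure.map_map (hpr n) hmp.measurable,
      Measure.map_map ((hpr n).comp hmp.measurable) hXm]
    congr 1
    funext ω j
    simp only [pastAt, Function.comp, shift]
    congr 1
    ring
  induction n using Int.induction_on with
  | zero => rfl
  | succ n ih => rw [step, ih]
  | pred n ih => rw [← ih, ← step, sub_add_cancel]

end Law

section Measurable

variable {A : Type*} [Fintype A] [MeasurableSpace A] {P : TransitionKernel A}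

lemma TransitionKernel.measurable_transfer (hPm : ∀ a, Measurable fun w => P.prob w a)
    {f : (ℕ → A) → ℝ} (hf : Measurable f) : Measurable (P.transfer f) :=
  Finset.measurable_fun_sum _ fun a _ => (hPm a).mul (hf.comp (measurable_snoc a))

lemma TransitionKernel.measurable_iterate_transfer (hPm : ∀ a, Measurable fun w => P.prob w a)
    {f : (ℕ → A) → ℝ} (hf : Measurable f) (n : ℕ) : Measurable (P.transfer^[n] f) := by
  induction n with
  | zero => exact hf
  | succ n ih =>
    rw [Function.iterate_succ_apply']
    exact measurable_transfer hPm ih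

end Measurable

/-! ### Duality between the transfer operator and the process. -/

section Compatible

variable {Ω A : Type*} [MeasurableSpace Ω] [Fintype A] [MeasurableSpace A]
  [MeasurableSingletonClass A] {X : ℤ → Ω → A} {μ : Measure Ω} [IsProbabilityMeasure μ]
  {P : TransitionKernel A}

lemma integrable_of_mem_Icc {α : Type*} [MeasurableSpace α] {ν : Measure α} [IsFiniteMeasure ν]
    {f : α → ℝ} (hf : Measurable f) (h01 : ∀ x, f x ∈ Set.Icc (0 : ℝ) 1) : Integrable f ν :=
  Integrable.of_bound hf.aestronglyMeasurable 1 <| .of_forall fun x => by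
    rw [Real.norm_eq_abs, abs_le]
    exact ⟨by linarith [(h01 x).1], (h01 x).2⟩

/-- Compatibility, integrated over an event of the past. -/
lemma IsCompatible.setIntegral_eq (hP : IsCompatible X μ P) (hX : ∀ n, Measurable (X n)) (a : A)
    {B : Set (ℕ → A)} (hB : MeasurableSet B) {h : (ℕ → A) → ℝ} (hh : Measurable h)
    (h01 : ∀ w, h w ∈ Set.Icc (0 : ℝ) 1) :
    ∫ ω in pastAt X (-1) ⁻¹' B, (X 0 ⁻¹' {a}).indicator (fun _ => (1 : ℝ)) ω * h (pastAt X (-1) ω) ∂μ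
      = ∫ ω in pastAt X (-1) ⁻¹' B, P.prob (pastAt X (-1) ω) a * h (pastAt X (-1) ω) ∂μ := by
  have hm := sigmaOf_le hX (Set.Iic (-1))
  have hY := measurable_pastAt_sigmaOf X (-1)
  have hE : MeasurableSet[sigmaOf X (Set.Iic (-1))] (pastAt X (-1) ⁻¹' B) := hY hB
  have hXa : MeasurableSet (X 0 ⁻¹' {a}) := hX 0 (measurableSet_singleton a)
  have hind : Measurable ((X 0 ⁻¹' {a}).indicator (fun _ => (1 : ℝ))) :=
    measurable_const.indicator hXa
  have hind01 : ∀ ω, (X 0 ⁻¹' {a}).indicator (fun _ => (1 : ℝ)) ω ∈ Set.Icc (0 : ℝ) 1 := fun ω => by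
    by_cases hω : ω ∈ X 0 ⁻¹' {a} <;> simp [hω]
  have hhY : Measurable fun ω => h (pastAt X (-1) ω) := hh.comp (measurable_pastAt hX (-1))
  have hint : Integrable ((X 0 ⁻¹' {a}).indicator (fun _ => (1 : ℝ)) * fun ω => h (pastAt X (-1) ω)) μ :=
    integrable_of_mem_Icc (hind.mul hhY) fun ω =>
      ⟨mul_nonneg (hind01 ω).1 (h01 _).1, mul_le_one₀ (hind01 ω).2 (h01 _).1 (h01 _).2⟩
  -- The factor `h` depends only on the past, so it leaves the conditional expectation.
  have hpull := condExp_mul_of_stronglyMeasurable_right (m := sigmaOf X (Set.Iic (-1))) (hh.comp hY).stronglyMeasurable hint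
    (integrable_of_mem_Icc hind hind01)
  refine (setIntegral_condExp hm hint hE).symm.trans ?_
  refine setIntegral_congr_ae (hm _ hE) ?_
  filter_upwards [hpull, hP a] with ω h1 h2 _
  refine h1.trans ?_
  rw [Pi.mul_apply, h2]
  rfl

/-- The transfer operator is dual to the deletion of the most recent letter. -/
lemma setIntegral_preimage_tail (hX : IsStationaryErgodic X μ) (hP : IsCompatible X μ P)
    (hPm : ∀ a, Measurable fun w => P.prob w a) {B : Set (ℕ → A)} (hB : MeasurableSet B)
    {f : (ℕ → A) → ℝ} (hf : Measurable f) (h01 : ∀ w, f w ∈ Set.Icc (0 : ℝ) 1) :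
    ∫ w in tail ⁻¹' B, f w ∂(μ.map (pastAt X 0))
      = ∫ w in B, P.transfer f w ∂(μ.map (pastAt X 0)) := by
  have hTf := TransitionKernel.measurable_transfer hPm hf
  have hY := measurable_pastAt hX.measurable
  rw [setIntegral_map (measurable_tail hB) hf.aestronglyMeasurable (hY 0).aemeasurable,
    ← hX.map_pastAt (-1),
    setIntegral_map hB hTf.aestronglyMeasurable (hY (-1)).aemeasurable]
  have hpre : pastAt X 0 ⁻¹' (tail ⁻¹' B) = pastAt X (-1) ⁻¹' B := by
    ext ω
    have := iterate_tail_pastAt X (-1) 1 ω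
    simp only [Function.iterate_one, Nat.cast_one, neg_add_cancel] at this
    simp only [Set.mem_preimage, this]
  have hsum : ∀ ω, f (pastAt X 0 ω) = ∑ a, (X 0 ⁻¹' {a}).indicator (fun _ => (1 : ℝ)) ω *
      f (snoc a (pastAt X (-1) ω)) := by
    intro ω
    rw [Finset.sum_eq_single (X 0 ω)]
    · simp [snoc_pastAt]
    · intro a _ ha
      simp [Set.indicator, ha.symm]
    · simp
  have hfs : ∀ a, Measurable fun ω => f (snoc a (pastAt X (-1) ω)) := fun a =>
    hf.comp ((measurable_snoc a).comp (hY (-1)))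
  rw [hpre]
  simp only [hsum, TransitionKernel.transfer]
  rw [integral_finsetSum, integral_finsetSum]
  · exact Finset.sum_congr rfl fun a _ => hP.setIntegral_eq hX.measurable a hB
      (hf.comp (measurable_snoc a)) fun w => h01 _
  · intro a _
    refine integrable_of_mem_Icc (((hPm a).comp (hY (-1))).mul (hfs a)) fun ω =>
      ⟨mul_nonneg (P.prob_mem _ a).1 (h01 _).1,
        mul_le_one₀ (P.prob_mem _ a).2 (h01 _).1 (h01 _).2⟩
  · intro a _
    have hind01 : ∀ ω, (X 0 ⁻¹' {a}).indicator (fun _ => (1 : ℝ)) ω ∈ Set.Icc (0 : ℝ) 1 :=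
      fun ω => by by_cases hω : ω ∈ X 0 ⁻¹' {a} <;> simp [hω]
    refine integrable_of_mem_Icc ((measurable_const.indicator
      (hX.measurable 0 (measurableSet_singleton a))).mul (hfs a)) fun ω =>
      ⟨mul_nonneg (hind01 ω).1 (h01 _).1, mul_le_one₀ (hind01 ω).2 (h01 _).1 (h01 _).2⟩

lemma setIntegral_preimage_iterate_tail (hX : IsStationaryErgodic X μ) (hP : IsCompatible X μ P)
    (hPm : ∀ a, Measurable fun w => P.prob w a) {B : Set (ℕ → A)} (hB : MeasurableSet B)
    {f : (ℕ → A) → ℝ} (hf : Measurable f) (h01 : ∀ w, f w ∈ Set.Icc (0 : ℝ) 1) (n : ℕ) :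
    ∫ w in tail^[n] ⁻¹' B, f w ∂(μ.map (pastAt X 0))
      = ∫ w in B, P.transfer^[n] f w ∂(μ.map (pastAt X 0)) := by
  induction n generalizing f with
  | zero => rfl
  | succ n ih =>
    rw [Function.iterate_succ, Set.preimage_comp,
      setIntegral_preimage_tail hX hP hPm (measurable_iterate_tail n hB) hf h01,
      ih (TransitionKernel.measurable_transfer hPm hf) (P.transfer_mem_Icc h01),
      Function.iterate_succ_apply]

/-- A small oscillation of `T^n f` makes the covariances with events of the remote past small. -/
lemma abs_setIntegral_sub_le (hX : IsStationaryErgodic X μ) (hP : IsCompatible X μ P)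
    (hPm : ∀ a, Measurable fun w => P.prob w a) {B : Set (ℕ → A)} (hB : MeasurableSet B)
    {f : (ℕ → A) → ℝ} (hf : Measurable f) (h01 : ∀ w, f w ∈ Set.Icc (0 : ℝ) 1) {n : ℕ} {c : ℝ}
    (hc : ∀ w w', |P.transfer^[n] f w - P.transfer^[n] f w'| ≤ c) (w₀ : ℕ → A) :
    |∫ w in tail^[n] ⁻¹' B, f w ∂(μ.map (pastAt X 0))
        - (μ.map (pastAt X 0)).real B * ∫ w, f w ∂(μ.map (pastAt X 0))|
      ≤ 2 * c * (μ.map (pastAt X 0)).real B := by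
  have : IsProbabilityMeasure (μ.map (pastAt X 0)) :=
    Measure.isProbabilityMeasure_map (measurable_pastAt hX.measurable 0).aemeasurable
  set ν := μ.map (pastAt X 0) with hν
  set g := P.transfer^[n] f with hg
  have hgi : Integrable g ν := integrable_of_mem_Icc (TransitionKernel.measurable_iterate_transfer hPm hf n)
    (P.iterate_transfer_mem_Icc h01 n)
  -- Both integrals are compared with the constant `g w₀`, for `S = B` and for the whole space; this
  -- gives the factor `2`.
  have key : ∀ S : Set (ℕ → A), |∫ w in S, g w ∂ν - ν.real S * g w₀| ≤ c * ν.real S := by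
    intro S
    have h1 : ∫ w in S, (g w - g w₀) ∂ν = ∫ w in S, g w ∂ν - ν.real S * g w₀ := by
      rw [integral_sub hgi.integrableOn (integrable_const _), setIntegral_const, smul_eq_mul]
    rw [← h1, ← Real.norm_eq_abs]
    exact norm_setIntegral_le_of_norm_le_const (measure_lt_top ν S) fun w _ => hc w w₀
  have hB' := setIntegral_preimage_iterate_tail hX hP hPm hB hf h01 n
  have hU := setIntegral_preimage_iterate_tail hX hP hPm MeasurableSet.univ hf h01 n
  rw [Set.preimage_univ, setIntegral_univ] at hU
  have h1 := key B
  have h2 := key Set.univ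
  rw [← hB'] at h1
  rw [← hU, probReal_univ, one_mul, mul_one] at h2
  have h3 := mul_le_mul_of_nonneg_left h2 (measureReal_nonneg (μ := ν) (s := B))
  rw [← abs_of_nonneg (measureReal_nonneg (μ := ν) (s := B)), ← abs_mul,
    abs_of_nonneg (measureReal_nonneg (μ := ν) (s := B))] at h3
  rw [abs_le] at *
  constructor <;> nlinarith [h1.1, h1.2, h3.1, h3.2]

end Compatible

/-! ### From covariances to mixing coefficients. -/

section Mixing

open scoped symmDiff

/-- A covariance bound for single events bounds the `β`-mixing coefficient. -/
lemma betaCoeff_le {Ω : Type*} {m₁ m₂ : MeasurableSpace Ω} [m0 : MeasurableSpace Ω]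
    {μ : Measure Ω} [IsProbabilityMeasure μ] (h₁ : m₁ ≤ m0) (h₂ : m₂ ≤ m0) {c : ℝ} (hc : 0 ≤ c)
    (h : ∀ E F, MeasurableSet[m₁] E → MeasurableSet[m₂] F →
      |μ.real (E ∩ F) - μ.real E * μ.real F| ≤ c * μ.real E) :
    betaCoeff m₁ m₂ μ ≤ c := by
  have key : sSup (betaSums m₁ m₂ μ) ≤ 2 * c := by
    refine Real.sSup_le ?_ (by positivity)
    rintro _ ⟨I, J, E, F, hE, hF, rfl⟩
    -- Covariance is additive over disjoint `F j`, so the terms of each sign merge into one event;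
    -- the resulting factor `2` cancels the `1 / 2` in `betaCoeff`.
    have hfin : ∀ i, ∀ s : Finset (Fin J),
        |∑ j ∈ s, (μ.real (E i ∩ F j) - μ.real (E i) * μ.real (F j))| ≤ c * μ.real (E i) := by
      intro i s
      have hFm : ∀ j, MeasurableSet[m0] (F j) := fun j => h₂ _ (hF.measurableSet j)
      have hEm : MeasurableSet[m0] (E i) := h₁ _ (hE.measurableSet i)
      have hU := h (E i) (⋃ j ∈ s, F j) (hE.measurableSet i)
        (s.measurableSet_biUnion fun j _ => hF.measurableSet j)
      rw [Set.inter_iUnion₂,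
        measureReal_biUnion_finset (fun j _ j' _ hj => hF.disjoint hj) (fun j _ => hFm j),
        measureReal_biUnion_finset
          (fun j _ j' _ hj => (hF.disjoint hj).mono Set.inter_subset_right Set.inter_subset_right)
          (fun j _ => hEm.inter (hFm j)), Finset.mul_sum, ← Finset.sum_sub_distrib] at hU
      exact hU
    have hrow : ∀ i, ∑ j, |μ.real (E i ∩ F j) - μ.real (E i) * μ.real (F j)|
        ≤ 2 * c * μ.real (E i) := by
      intro i
      set x : Fin J → ℝ := fun j => μ.real (E i ∩ F j) - μ.real (E i) * μ.real (F j)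
      have hpos := (abs_le.1 (hfin i (Finset.univ.filter fun j => 0 ≤ x j))).2
      have hneg := (abs_le.1 (hfin i (Finset.univ.filter fun j => ¬ 0 ≤ x j))).1
      have h1 : ∑ j ∈ Finset.univ.filter (fun j => 0 ≤ x j), |x j|
          = ∑ j ∈ Finset.univ.filter (fun j => 0 ≤ x j), x j :=
        Finset.sum_congr rfl fun j hj => abs_of_nonneg (Finset.mem_filter.1 hj).2
      have h2 : ∑ j ∈ Finset.univ.filter (fun j => ¬ 0 ≤ x j), |x j|
          = -∑ j ∈ Finset.univ.filter (fun j => ¬ 0 ≤ x j), x j := by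
        rw [← Finset.sum_neg_distrib]
        exact Finset.sum_congr rfl fun j hj => abs_of_neg (not_le.1 (Finset.mem_filter.1 hj).2)
      calc ∑ j, |x j| = ∑ j ∈ Finset.univ.filter (fun j => 0 ≤ x j), |x j|
            + ∑ j ∈ Finset.univ.filter (fun j => ¬ 0 ≤ x j), |x j| :=
            (Finset.sum_filter_add_sum_filter_not _ _ _).symm
        _ ≤ 2 * c * μ.real (E i) := by rw [h1, h2]; linarith
    have hE1 : ∑ i, μ.real (E i) = 1 := by
      simpa using hE.sum_real_inter (μ := μ) h₁ MeasurableSet.univ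
    calc _ ≤ ∑ i, 2 * c * μ.real (E i) := Finset.sum_le_sum fun i _ => hrow i
      _ = 2 * c := by rw [← Finset.mul_sum, hE1, mul_one]
  unfold betaCoeff
  linarith

lemma abs_cov_le {Ω : Type*} [MeasurableSpace Ω] (μ : Measure Ω) [IsProbabilityMeasure μ]
    (E F : Set Ω) : |μ.real (E ∩ F) - μ.real E * μ.real F| ≤ μ.real E := by
  have h1 : μ.real (E ∩ F) ≤ μ.real E := measureReal_mono Set.inter_subset_left
  have h2 : μ.real E * μ.real F ≤ μ.real E := mul_le_of_le_one_right measureReal_nonneg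
    measureReal_le_one
  have h3 : 0 ≤ μ.real (E ∩ F) := measureReal_nonneg
  have h4 : 0 ≤ μ.real E * μ.real F := mul_nonneg measureReal_nonneg measureReal_nonneg
  rw [abs_le]
  constructor <;> linarith

/-- A covariance bound for an approximation of an event. -/
lemma abs_cov_le_of_symmDiff {Ω : Type*} [MeasurableSpace Ω] {μ : Measure Ω}
    [IsProbabilityMeasure μ] {E F F' : Set Ω} (hE : MeasurableSet E) (hF : MeasurableSet F)
    (hF' : MeasurableSet F') {b ε : ℝ} (hε : μ.real (F' ∆ F) ≤ ε)
    (h : |μ.real (E ∩ F') - μ.real E * μ.real F'| ≤ b) :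
    |μ.real (E ∩ F) - μ.real E * μ.real F| ≤ b + 2 * ε := by
  have h1 : |μ.real F' - μ.real F| ≤ ε :=
    (abs_measureReal_sub_le_measureReal_symmDiff hF'.nullMeasurableSet hF.nullMeasurableSet).trans hε
  have h2 : |μ.real (E ∩ F') - μ.real (E ∩ F)| ≤ ε := by
    refine (abs_measureReal_sub_le_measureReal_symmDiff (hE.inter hF').nullMeasurableSet
      (hE.inter hF).nullMeasurableSet).trans ((measureReal_mono ?_).trans hε)
    rw [← Set.inter_symmDiff_distrib_left]
    exact Set.inter_subset_right
  have h3 : |μ.real E * (μ.real F' - μ.real F)| ≤ ε := by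
    rw [abs_mul, abs_of_nonneg measureReal_nonneg]
    exact (mul_le_of_le_one_left (abs_nonneg _) measureReal_le_one).trans h1
  rw [mul_sub] at h3
  rw [abs_le] at *
  constructor <;> linarith [h.1, h.2, h2.1, h2.2, h3.1, h3.2]

/-- A cylinder depends on finitely many letters. -/
lemma exists_agree_of_mem_measurableCylinders {A : Type*} [MeasurableSpace A] {D : Set (ℕ → A)}
    (hD : D ∈ measurableCylinders fun _ : ℕ => A) :
    ∃ r, ∀ x y, Agree r x y → (x ∈ D ↔ y ∈ D) := by
  obtain ⟨s, S, -, rfl⟩ := (mem_measurableCylinders D).1 hD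
  refine ⟨s.sup id + 1, fun x y hxy => ?_⟩
  have : s.restrict x = s.restrict y := by
    funext i
    exact hxy i (Nat.lt_succ_of_le (Finset.le_sup (f := id) i.2))
  rw [mem_cylinder, mem_cylinder, this]

variable {Ω A : Type*} [MeasurableSpace Ω] [Fintype A] [MeasurableSpace A]
  [MeasurableSingletonClass A] {X : ℤ → Ω → A} {μ : Measure Ω} [IsProbabilityMeasure μ]
  {P : TransitionKernel A}

/-- The covariance bound for events of the future that depend on finitely many letters. -/
lemma abs_cov_le_of_cylinder (hX : IsStationaryErgodic X μ) (hP : IsCompatible X μ P)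
    (hPm : ∀ a, Measurable fun w => P.prob w a) {k : ℕ} {c : ℝ} [Nonempty A]
    (hc : ∀ (r : ℕ) (f : (ℕ → A) → ℝ), (∀ w, f w ∈ Set.Icc (0 : ℝ) 1) →
      (∀ w w', Agree r w w' → f w = f w') →
      ∀ w w', |P.transfer^[k + r] f w - P.transfer^[k + r] f w'| ≤ c)
    {B D : Set (ℕ → A)} (hB : MeasurableSet B) (hD : D ∈ measurableCylinders fun _ : ℕ => A) :
    |μ.real (pastAt X 0 ⁻¹' B ∩ futureAt X (k + 1 : ℕ) ⁻¹' D)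
        - μ.real (pastAt X 0 ⁻¹' B) * μ.real (futureAt X (k + 1 : ℕ) ⁻¹' D)|
      ≤ 2 * c * μ.real (pastAt X 0 ⁻¹' B) := by
  obtain ⟨r, hr⟩ := exists_agree_of_mem_measurableCylinders hD
  have hDm : MeasurableSet D := .of_mem_measurableCylinders hD
  -- Seen from time `k + r`, the letters at times `k + 1, …, k + r` are the `r` most recent ones in
  -- reverse order. Truncated subtraction for `i ≥ r` is harmless, as `D` reads only `r` letters.
  set ρ : (ℕ → A) → ℕ → A := fun w i => w (r - 1 - i) with hρ
  have hρm : Measurable ρ := measurable_pi_lambda _ fun i => measurable_pi_apply _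
  have hD' : MeasurableSet (ρ ⁻¹' D) := hρm hDm
  set f : (ℕ → A) → ℝ := (ρ ⁻¹' D).indicator 1 with hf
  have hfm : Measurable f := measurable_one.indicator hD'
  have h01 : ∀ w, f w ∈ Set.Icc (0 : ℝ) 1 := fun w => by
    by_cases hw : w ∈ ρ ⁻¹' D <;> simp [hf, hw]
  have hfr : ∀ w w', Agree r w w' → f w = f w' := fun w w' hw => by
    have hiff : w ∈ ρ ⁻¹' D ↔ w' ∈ ρ ⁻¹' D := hr _ _ fun i hi => hw _ (by omega)
    by_cases h : w ∈ ρ ⁻¹' D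
    · simp [hf, h, hiff.1 h]
    · simp [hf, h, mt hiff.2 h]
  have hcov := abs_setIntegral_sub_le hX hP hPm hB hfm h01 (hc r f h01 hfr)
    fun _ => Classical.arbitrary A
  have hY := measurable_pastAt hX.measurable
  have hpast : pastAt X (k + r : ℕ) ⁻¹' (tail^[k + r] ⁻¹' B) = pastAt X 0 ⁻¹' B := by
    ext ω
    have := iterate_tail_pastAt X 0 (k + r) ω
    rw [zero_add] at this
    simp only [Set.mem_preimage, this]
  have hfut : pastAt X (k + r : ℕ) ⁻¹' (ρ ⁻¹' D) = futureAt X (k + 1 : ℕ) ⁻¹' D := by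
    ext ω
    refine hr _ _ fun i hi => ?_
    simp only [hρ, pastAt, futureAt]
    congr 1
    omega
  rw [setIntegral_indicator hD', integral_indicator_one hD'] at hcov
  simp only [Pi.one_apply, setIntegral_const, smul_eq_mul, mul_one] at hcov
  rw [map_measureReal_apply (hY 0) hB] at hcov
  -- Stationarity lets the same law be read at time `k + r`, where deleting `k + r` letters leads
  -- back to time `0`.
  rw [← hX.map_pastAt (k + r : ℕ), map_measureReal_apply (hY _) hD',
    map_measureReal_apply (hY _) ((measurable_iterate_tail _ hB).inter hD'),
    Set.preimage_inter, hpast, hfut] at hcov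
  exact hcov

/-- The covariance bound for all events of the future. -/
lemma abs_cov_le_of_osc (hX : IsStationaryErgodic X μ) (hP : IsCompatible X μ P)
    (hPm : ∀ a, Measurable fun w => P.prob w a) {k : ℕ} {c : ℝ} [Nonempty A]
    (hc : ∀ (r : ℕ) (f : (ℕ → A) → ℝ), (∀ w, f w ∈ Set.Icc (0 : ℝ) 1) →
      (∀ w w', Agree r w w' → f w = f w') →
      ∀ w w', |P.transfer^[k + r] f w - P.transfer^[k + r] f w'| ≤ c)
    {E F : Set Ω} (hE : MeasurableSet[sigmaOf X (Set.Iic 0)] E)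
    (hF : MeasurableSet[sigmaOf X (Set.Ici ((k + 1 : ℕ) : ℤ))] F) :
    |μ.real (E ∩ F) - μ.real E * μ.real F| ≤ 2 * c * μ.real E := by
  obtain ⟨B, hB, rfl⟩ := sigmaOf_Iic_le X 0 E hE
  obtain ⟨D, hD, rfl⟩ := sigmaOf_Ici_le X (k + 1 : ℕ) F hF
  have hY := measurable_pastAt hX.measurable 0
  have hZ := measurable_futureAt hX.measurable (k + 1 : ℕ)
  refine le_of_forall_pos_le_add fun ε hε => ?_
  -- The cylinder bound does not depend on `r`, so it passes to the limit of cylinder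
  -- approximations.
  obtain ⟨D', hD', hDD'⟩ := exists_measure_symmDiff_lt_of_generateFrom_isSetRing
    (μ := μ.map (futureAt X (k + 1 : ℕ))) (isSetRing_measurableCylinders (α := fun _ : ℕ => A))
    ⟨{Set.univ}, Set.countable_singleton _,
      Set.singleton_subset_iff.2 (univ_mem_measurableCylinders _), by simp⟩
    generateFrom_measurableCylinders.symm hD (ε := ENNReal.ofReal (ε / 2)) (by simpa using hε)
  have hDm : MeasurableSet D' := .of_mem_measurableCylinders hD'
  rw [Measure.map_apply hZ (hDm.symmDiff hD)] at hDD'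
  have hsymm : μ.real ((futureAt X (k + 1 : ℕ) ⁻¹' D') ∆ (futureAt X (k + 1 : ℕ) ⁻¹' D)) ≤ ε / 2 :=
    ENNReal.toReal_le_of_le_ofReal (by positivity) hDD'.le
  have := abs_cov_le_of_symmDiff (hY hB) (hZ hD) (hZ hDm) hsymm
    (abs_cov_le_of_cylinder hX hP hPm hc hB hD')
  linarith

end Mixing

end ChainMixing
end

theorem mainTheorem10 {Ω A : Type*} [MeasurableSpace Ω] [Fintype A] [MeasurableSpace A]
    [MeasurableSingletonClass A] (μ : Measure Ω) [IsProbabilityMeasure μ] (X : ℤ → Ω → A)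
    (hX : ChainMixing.IsStationaryErgodic X μ) (P : ChainMixing.TransitionKernel A)
    (hP : ChainMixing.IsCompatible X μ P) (hRC : ChainMixing.RC P)
    (hε : ChainMixing.ExpContinuityDecay P) :
    ChainMixing.GMC X μ := by
  open ChainMixing in
  have hA : Nonempty A := (nonempty_of_isProbabilityMeasure μ).map (X 0)
  -- The discrete topology makes the space of pasts compact; continuity of the kernel then also
  -- supplies its measurability.
  let _ : TopologicalSpace A := ⊥
  have : DiscreteTopology A := ⟨rfl⟩
  obtain ⟨D, θ, hD, hD0, hθ, hθ1⟩ := TransitionKernel.exists_hasRate hε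
  have hPc := hD.continuous hθ hθ1
  obtain ⟨p, hp, hpP⟩ := TransitionKernel.exists_pos_le_prob hPc hRC
  obtain ⟨L, γ, hL, hγ, hosc⟩ := TransitionKernel.exists_osc_iterate_le hD hD0 hθ hθ1 hp hpP
  have hPm : ∀ a, Measurable fun w => P.prob w a := fun a => (hPc a).measurable
  have hle := sigmaOf_le hX.measurable
  -- A gap `k + 1` yields decay `exp (-γ * k)`, hence the factor `exp γ`; the `1` covers gap `0` by
  -- `abs_cov_le`.
  refine ⟨2 * L * Real.exp γ + 1, γ, by positivity, hγ, fun k => ?_⟩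
  refine betaCoeff_le (hle _) (hle _) (by positivity) fun E F hE hF => ?_
  rcases k with _ | k
  · refine (abs_cov_le μ E F).trans (le_mul_of_one_le_left measureReal_nonneg ?_)
    have : 0 < L * Real.exp γ := by positivity
    simp
    linarith
  · refine (abs_cov_le_of_osc hX hP hPm (hosc k) hE hF).trans
      (mul_le_mul_of_nonneg_right ?_ measureReal_nonneg)
    have h1 : Real.exp (-γ * k) = Real.exp γ * Real.exp (-γ * (k + 1 : ℕ)) := by
      rw [← Real.exp_add]
      congr 1
      push_cast
      ring
    have h2 := Real.exp_pos (-γ * (k + 1 : ℕ))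
    rw [h1]
    linarith
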